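/- Fix $p\in(0,1)$ and put $q=1-p$. For $n\ge 1$, the careless coupon collector with $n$ coupon types is the Markov chain $(S_t)_{t\ge0}$ of subsets of $[n]=\{1,\dots,n\}$ with $S_0=\emptyset$ and $$S_{t+1}=(S_t\cup\{J_{t+1}\})\setminus\{i\in[n]:L_{i,t+1}=1\},$$ where all the variables $J_t$, $L_{i,t}$ ($t\ge1$, $i\in[n]$) are independent, $J_t$ is uniform on $[n]$, and $L_{i,t}$ is Bernoulli with $\mathbb P(L_{i,t}=1)=p$. Let $K_t=|S_t|$, and let $T_{n,p}=\inf\{t\ge0:S_t=[n]\}$ be the post-loss completion time. **Theorem.** For every $n\ge1$, $K_t$ is a Markov chain on $\{0,\dots,n\}$ which from state $k$ moves to a $\mathrm{Bin}(k,q)$ value with probability $k/n$ and to a $\mathrm{Bin}(k+1,q)$ value with probability $(n-k)/n$; this chain has a unique stationary law $\nu_n$; and $T_{n,p}<\infty$ almost surely. With the stationary-entry flux $$\mu_n:=\mathbb P_{\nu_n}(K_0<n,\ K_1=n),$$ one has, as $n\to\infty$, $$\mu_nT_{n,p}\Rightarrow\mathrm{Exp}(1)$$ (convergence in distribution), and $$\mu_n\sim\frac1{(q;q)_\infty}\,\frac{n!}{n^n}\,q^{n(n+1)/2},\qquad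 (q;q)_\infty:=\prod_{r=1}^{\infty}(1-q^r).$$ -/

import Mathlib

open MeasureTheory ProbabilityTheory Filter Topology
open scoped Asymptotics

namespace CarelessCollector

/-- The randomness of one round with `n` coupon types: the type drawn, and for every type a flag
saying whether the loss step removes that type (`true` means lost). -/
abbrev Round (n : ℕ) : Type := Fin n × (Fin n → Bool)

/-- The law of one round: the drawn type is uniform, the loss flags are independent Bernoulli
variables, each equal to `true` with probability `p`, and draw and flags are independent. -/
noncomputable def roundLaw (n : ℕ) [NeZero n] (p : unitInterval) : Measure (Round n) :=
  (PMF.uniformOfFintype (Fin n)).toMeasure.prod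
    (Measure.pi fun _ : Fin n => bernoulliMeasure true false p)

instance (n : ℕ) [NeZero n] (p : unitInterval) : IsProbabilityMeasure (roundLaw n p) := by
  unfold roundLaw; infer_instance

/-- One round: the drawn coupon is added, then every held coupon (possibly including the one just
drawn) whose loss flag is `true` is removed. -/
def step {n : ℕ} (S : Finset (Fin n)) (r : Round n) : Finset (Fin n) :=
  (insert r.1 S).filter fun i => r.2 i = false

/-- The set of coupons held after the loss step of round `t`, starting from the empty collection;
`ω t` is the randomness used in round `t + 1`. -/
def held {n : ℕ} (ω : ℕ → Round n) : ℕ → Finset (Fin n)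
  | 0 => ∅
  | t + 1 => step (held ω t) (ω t)

/-- The law of the whole experiment: the rounds are independent and identically distributed. -/
noncomputable def experiment (n : ℕ) [NeZero n] (p : unitInterval) : Measure (ℕ → Round n) :=
  Measure.infinitePi fun _ : ℕ => roundLaw n p

instance (n : ℕ) [NeZero n] (p : unitInterval) : IsProbabilityMeasure (experiment n p) := by
  unfold experiment; infer_instance

/-- The post-loss completion time `inf {t : S_t = [n]}`, equal to `⊤` if this set is empty. -/
noncomputable def completionTime {n : ℕ} (ω : ℕ → Round n) : ℕ∞ :=
  ⨅ (t : ℕ) (_ : held ω t = Finset.univ), (t : ℕ∞)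

/-- The mass that the binomial law `Bin(m, q)` gives to `l`. -/
def binomialMass (m : ℕ) (q : ℝ) (l : ℕ) : ℝ :=
  m.choose l * q ^ l * (1 - q) ^ (m - l)

/-- The transition matrix of the count chain `K_t = |S_t|` on `{0, …, n}`: from `k`, move to a
`Bin(k, q)` value with probability `k / n` and to a `Bin(k + 1, q)` value with probability
`(n - k) / n`. -/
noncomputable def countTransition (n : ℕ) (q : ℝ) : Matrix (Fin (n + 1)) (Fin (n + 1)) ℝ :=
  Matrix.of fun k l =>
    ((k : ℕ) : ℝ) / n * binomialMass k q l + ((n : ℝ) - ((k : ℕ) : ℝ)) / n * binomialMass (k + 1) q l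

/-- `ν` is a stationary probability vector of the count chain. -/
def IsCountStationary (n : ℕ) (q : ℝ) (ν : Fin (n + 1) → ℝ) : Prop :=
  ν ∈ stdSimplex ℝ (Fin (n + 1)) ∧ Matrix.vecMul ν (countTransition n q) = ν

/-- The flux `P_ν(K_0 < n, K_1 = n)` of the count chain into the state `n`. -/
noncomputable def entryFlux (n : ℕ) (q : ℝ) (ν : Fin (n + 1) → ℝ) : ℝ :=
  ∑ k : Fin n, ν k.castSucc * countTransition n q k.castSucc (Fin.last n)

/-- The infinite product `(a; a)_∞ = ∏_{r ≥ 1} (1 - a ^ r)`. -/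
noncomputable def qProd (a : ℝ) : ℝ := ∏' r : ℕ, (1 - a ^ (r + 1))

instance : IsProbabilityMeasure (expMeasure 1) := isProbabilityMeasure_expMeasure one_pos

end CarelessCollector

namespace CarelessCollector

/-! Everything is computed in the basis of binomial coefficients $\binom{k}{m}$, in which the count
chain is bidiagonal (`sum_countTransition_mul_choose_succ`). Put $a_m=q^m(1-m/n)$,
$D_n(z)=\prod_{m=1}^n(1-za_m)$ and $f_n=\frac{n!}{n^n}q^{n(n+1)/2}$. Stationarity becomes a
first-order recursion for the binomial moments, which fixes them all; the $n$-th one is the mass at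
$n$, so $\nu_n(n)=f_n/D_n(1)$ and $\mu_n=(1-q^n)f_n/D_n(1)$. Since $D_n(1)\to(q;q)_\infty$, the flux
asymptotics follow.

For $T$, let $F(z)=\mathbb E[z^T;T<\infty]$ and kill the chain on reaching $n$. The same moments
turn its one-step equations into a solvable recursion, and the killed occupation has no mass at $n$.
This yields (`hitting_identity`) $F(z)\,(z^nf_n+(1-z)\rho_n(z)D_n(z))=z^nf_n$, where $\rho_n$ is
`excursionMoment` at index $n$, with $|\rho_n-1|\le q^n/(1-q)$ on the closed unit disc.

At $z=1$ the identity gives $F(1)=1$, so $T<\infty$ almost surely. At $z=e^{is\mu_n}$, dividing by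
$\mu_n$ and using $n\mu_n\to0$, $f_n/\mu_n\to(q;q)_\infty$ and $D_n(z)\to(q;q)_\infty$ gives
$F\to1/(1-is)$, the characteristic function of $\mathrm{Exp}(1)$; Lévy's continuity theorem
concludes. -/

/-! ### Binomial moments of the transition matrix -/

/-- Each $m$-subset of $M$ items survives independent thinning with probability $q^m$.
Algebraically, $\binom Ml\binom lm=\binom Mm\binom{M-m}{l-m}$ reduces the sum to the binomial
theorem. -/
lemma sum_binomialMass_mul_choose (q : ℝ) {M N : ℕ} (h : M ≤ N) (m : ℕ) :
    ∑ l : Fin (N + 1), binomialMass M q l * ((l : ℕ).choose m : ℝ) = q ^ m * M.choose m := by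
  rw [Fin.sum_univ_eq_sum_range (fun l => binomialMass M q l * (l.choose m : ℝ)) (N + 1)]
  rw [← Finset.sum_subset (Finset.range_mono (Nat.succ_le_succ h)) (by
    intro l _ hl
    have : M < l := by simpa using hl
    simp [binomialMass, Nat.choose_eq_zero_of_lt this])]
  rcases lt_or_ge M m with hm | hm
  · rw [Nat.choose_eq_zero_of_lt hm, Nat.cast_zero, mul_zero]
    refine Finset.sum_eq_zero fun l hl => ?_
    have : l < m := by simp at hl; omega
    simp [Nat.choose_eq_zero_of_lt this]
  · obtain ⟨j, rfl⟩ := Nat.exists_eq_add_of_le hm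
    rw [← Nat.add_one, add_assoc, Finset.sum_range_add, Finset.sum_eq_zero (fun l hl => by
      simp [Nat.choose_eq_zero_of_lt (Finset.mem_range.1 hl)]), zero_add]
    have key : ∀ i ∈ Finset.range (j + 1),
        binomialMass (m + j) q (m + i) * ((m + i).choose m : ℝ) =
          q ^ m * (m + j).choose m * (q ^ i * (1 - q) ^ (j - i) * j.choose i) := by
      intro i hi
      have hc := Nat.choose_mul (n := m + j) (k := m + i) (s := m)
        (by omega)
      have hc' : ((m + j).choose (m + i) : ℝ) * (m + i).choose m =
          (m + j).choose m * j.choose i := by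
        have : m + j - m = j := by omega
        have h2 : m + i - m = i := by omega
        rw [this, h2] at hc
        exact_mod_cast hc
      have : m + j - (m + i) = j - i := by omega
      rw [binomialMass, this, pow_add]
      linear_combination (q ^ m * q ^ i * (1 - q) ^ (j - i)) * hc'
    rw [Finset.sum_congr rfl key, ← Finset.mul_sum, ← add_pow]
    simp

lemma sum_countTransition_mul_choose {n : ℕ} (q : ℝ) (k : Fin (n + 1)) (m : ℕ) :
    ∑ l, countTransition n q k l * ((l : ℕ).choose m : ℝ) =
      q ^ m * ((k : ℕ) / n * (k : ℕ).choose m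
        + ((n : ℝ) - (k : ℕ)) / n * ((k : ℕ) + 1).choose m) := by
  have h1 : ∀ l : Fin (n + 1), countTransition n q k l * ((l : ℕ).choose m : ℝ) =
      ((k : ℕ) : ℝ) / n * (binomialMass k q l * ((l : ℕ).choose m : ℝ)) +
        ((n : ℝ) - ((k : ℕ) : ℝ)) / n * (binomialMass (k + 1) q l * ((l : ℕ).choose m : ℝ)) := by
    intro l
    simp only [countTransition, Matrix.of_apply]
    ring
  simp only [h1, Finset.sum_add_distrib, ← Finset.mul_sum]
  rw [sum_binomialMass_mul_choose q (Nat.lt_succ_iff.1 k.2)]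
  -- For $k=n$ the law $\mathrm{Bin}(k+1,q)$ is not supported in $\{0,\dots,n\}$, but its weight
  -- $(n-k)/n$ vanishes.
  rcases (Nat.lt_succ_iff.1 k.2).lt_or_eq with hk | hk
  · rw [sum_binomialMass_mul_choose q (Nat.succ_le_of_lt hk)]
    ring
  · rw [hk]
    simp
    ring

lemma sum_countTransition {n : ℕ} (hn : n ≠ 0) (q : ℝ) (k : Fin (n + 1)) :
    ∑ l, countTransition n q k l = 1 := by
  have := sum_countTransition_mul_choose q k 0
  have hn' : (n : ℝ) ≠ 0 := by exact_mod_cast hn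
  simp only [Nat.choose_zero_right, Nat.cast_one, mul_one, pow_zero, one_mul] at this
  rw [this]
  field_simp
  ring

/-- Pascal's rule and $(m+1)\binom k{m+1}=(k-m)\binom km$ absorb the factor $k$, leaving
coefficients independent of $k$: the matrix is bidiagonal on binomial coefficients. -/
lemma sum_countTransition_mul_choose_succ {n : ℕ} (hn : n ≠ 0) (q : ℝ) (k : Fin (n + 1))
    (m : ℕ) :
    ∑ l, countTransition n q k l * ((l : ℕ).choose (m + 1) : ℝ) =
      q ^ (m + 1) * ((1 - (m + 1) / n) * (k : ℕ).choose (m + 1)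
        + ((n : ℝ) - m) / n * (k : ℕ).choose m) := by
  rw [sum_countTransition_mul_choose]
  have hn' : (n : ℝ) ≠ 0 := by exact_mod_cast hn
  have h2 : ((k : ℕ).choose (m + 1) : ℝ) * (m + 1) = (k : ℕ).choose m * ((k : ℕ) - m) := by
    rcases lt_or_ge (k : ℕ) m with h | h
    · rw [Nat.choose_eq_zero_of_lt h, Nat.choose_eq_zero_of_lt (by omega)]; simp
    · have := Nat.choose_succ_right_eq (k : ℕ) m
      rw [← Nat.cast_sub h]
      exact_mod_cast this
  have h3 : (((k : ℕ) + 1).choose (m + 1) : ℝ) = (k : ℕ).choose m + (k : ℕ).choose (m + 1) := by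
    exact_mod_cast Nat.choose_succ_succ (k : ℕ) m
  rw [h3]
  field_simp
  linear_combination q ^ (m + 1) * h2

lemma countTransition_nonneg {n : ℕ} {q : ℝ} (h0 : 0 ≤ q) (h1 : q ≤ 1) (k l : Fin (n + 1)) :
    0 ≤ countTransition n q k l := by
  have hk : ((k : ℕ) : ℝ) ≤ n := by exact_mod_cast Nat.lt_succ_iff.1 k.2
  have hb : ∀ m i, 0 ≤ binomialMass m q i := fun m i => by
    have : 0 ≤ 1 - q := by linarith
    unfold binomialMass; positivity
  have : 0 ≤ (n : ℝ) - (k : ℕ) := by linarith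
  simp only [countTransition, Matrix.of_apply]
  have := hb k l
  have := hb (k + 1) l
  positivity

/-- A vector on `{0, …, n}` is determined by its binomial moments. -/
lemma eq_zero_of_sum_mul_choose_eq_zero {n : ℕ} (v : Fin (n + 1) → ℝ)
    (h : ∀ m ≤ n, ∑ k, v k * ((k : ℕ).choose m : ℝ) = 0) : v = 0 := by
  -- The system is triangular, since $\binom km=0$ for $k<m$; it is solved from $k=n$ downwards, by
  -- induction on $j=n-k$.
  have key : ∀ j : ℕ, ∀ k : Fin (n + 1), n - (k : ℕ) = j → v k = 0 := by
    intro j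
    induction j using Nat.strong_induction_on with
    | _ j ih =>
      intro k hk
      have hs := h k (Nat.lt_succ_iff.1 k.2)
      rw [Finset.sum_eq_single k] at hs
      · simpa using hs
      · intro l _ hl
        rcases lt_or_gt_of_ne hl with h' | h'
        · rw [Nat.choose_eq_zero_of_lt (by exact_mod_cast h')]; simp
        · rw [ih (n - (l : ℕ)) (by have := k.2; have := l.2; have : (k : ℕ) < l := h'; omega) l rfl,
            zero_mul]
      · simp
  ext k
  exact key _ k rfl

/-! ### Stationary law and entry flux -/

/-- The numerator `(n! / n ^ n) q ^ (n (n + 1) / 2)` of the mass that the stationary law of the count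
chain gives to `n`. -/
noncomputable def fullMass (n : ℕ) (q : ℝ) : ℝ :=
  (n.factorial / (n : ℝ) ^ n) * q ^ (n * (n + 1) / 2)

lemma fullMass_pos {n : ℕ} (hn : n ≠ 0) {q : ℝ} (hq : 0 < q) : 0 < fullMass n q := by
  unfold fullMass
  have : 0 < n := Nat.pos_of_ne_zero hn
  positivity

/-- The denominator `∏_{m = 1}^n (1 - z q ^ m (1 - m / n))`. -/
noncomputable def denomProd (n : ℕ) (q : ℝ) (z : ℂ) : ℂ :=
  ∏ m ∈ Finset.range n, (1 - z * ((q ^ (m + 1) * (1 - (m + 1) / n) : ℝ) : ℂ))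

lemma prod_momentRatio (n : ℕ) (q : ℝ) :
    ∏ m ∈ Finset.range n, (q ^ (m + 1) * ((n - m) / n)) = fullMass n q := by
  rw [Finset.prod_mul_distrib, Finset.prod_pow_eq_pow_sum, Finset.prod_div_distrib]
  have h1 : ∏ m ∈ Finset.range n, ((n : ℝ) - m) = n.factorial := by
    rw [← Nat.descFactorial_self, Nat.descFactorial_eq_prod_range, Nat.cast_prod]
    refine Finset.prod_congr rfl fun m hm => ?_
    rw [Nat.cast_sub (Finset.mem_range.1 hm).le]
  have h2 : ∑ m ∈ Finset.range n, (m + 1) = n * (n + 1) / 2 := by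
    have := Finset.sum_range_succ' (fun i => i) n
    have h3 := Finset.sum_range_id (n + 1)
    simp only [add_zero] at this
    rw [← this, h3, Nat.add_sub_cancel, mul_comm]
  rw [h1, h2, fullMass]
  simp
  ring

lemma momentFactor_nonneg {n m : ℕ} (hm : m < n) {q : ℝ} (h0 : 0 ≤ q) :
    0 ≤ q ^ (m + 1) * (1 - (m + 1) / n : ℝ) := by
  have hn : (0 : ℝ) < n := by exact_mod_cast (by omega : 0 < n)
  have : ((m : ℝ) + 1) / n ≤ 1 := by
    rw [div_le_one hn]; exact_mod_cast hm
  have : 0 ≤ 1 - ((m : ℝ) + 1) / n := by linarith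
  positivity

lemma momentFactor_le {m n : ℕ} {q : ℝ} (h0 : 0 ≤ q) :
    q ^ (m + 1) * (1 - (m + 1) / n : ℝ) ≤ q ^ (m + 1) := by
  have : 0 ≤ ((m : ℝ) + 1) / n := by positivity
  have h2 : 0 ≤ q ^ (m + 1) := by positivity
  nlinarith [mul_nonneg h2 this]

lemma one_sub_le_norm {a : ℝ} (ha : 0 ≤ a) {z : ℂ} (hz : ‖z‖ ≤ 1) :
    1 - a ≤ ‖1 - z * (a : ℂ)‖ := by
  have h := norm_sub_norm_le (1 : ℂ) (z * a)
  rw [norm_one, norm_mul, Complex.norm_real, Real.norm_of_nonneg ha] at h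
  nlinarith [norm_nonneg z]

lemma momentFactor_lt_one {m n : ℕ} {q : ℝ} (h0 : 0 ≤ q) (h1 : q < 1) :
    q ^ (m + 1) * (1 - (m + 1) / n : ℝ) < 1 :=
  momentFactor_le h0 |>.trans_lt (pow_lt_one₀ h0 h1 (by omega))

lemma one_sub_momentFactor_ne_zero {m n : ℕ} {q : ℝ} (h0 : 0 ≤ q) (h1 : q < 1) (hm : m < n)
    {z : ℂ} (hz : ‖z‖ ≤ 1) :
    1 - z * ((q ^ (m + 1) * (1 - (m + 1) / n) : ℝ) : ℂ) ≠ 0 := by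
  have := one_sub_le_norm (momentFactor_nonneg hm h0) hz
  have h2 := momentFactor_lt_one (m := m) (n := n) h0 h1
  exact norm_pos_iff.1 (by linarith)

lemma denomProd_ne_zero {n : ℕ} {q : ℝ} (h0 : 0 ≤ q) (h1 : q < 1) {z : ℂ} (hz : ‖z‖ ≤ 1) :
    denomProd n q z ≠ 0 :=
  Finset.prod_ne_zero_iff.2 fun _ hm =>
    one_sub_momentFactor_ne_zero h0 h1 (Finset.mem_range.1 hm) hz

lemma IsCountStationary.sum_mul_choose_succ {n : ℕ} (hn : n ≠ 0) {q : ℝ}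
    {ν : Fin (n + 1) → ℝ} (h : IsCountStationary n q ν) (m : ℕ) :
    (∑ k, ν k * ((k : ℕ).choose (m + 1) : ℝ)) * (1 - q ^ (m + 1) * (1 - (m + 1) / n)) =
      q ^ (m + 1) * ((n - m) / n) * ∑ k, ν k * ((k : ℕ).choose m : ℝ) := by
  have h1 : ∑ k, ν k * ((k : ℕ).choose (m + 1) : ℝ) =
      ∑ k, ν k * ∑ l, countTransition n q k l * ((l : ℕ).choose (m + 1) : ℝ) := by
    conv_lhs => rw [← h.2]
    simp only [Matrix.vecMul, dotProduct, Finset.sum_mul, Finset.mul_sum]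
    rw [Finset.sum_comm]
    simp only [mul_assoc]
  simp only [sum_countTransition_mul_choose_succ hn] at h1
  have h2 : ∀ k : Fin (n + 1), ν k * (q ^ (m + 1) * ((1 - (m + 1) / n) * ((k : ℕ).choose (m + 1) : ℝ)
        + ((n : ℝ) - m) / n * ((k : ℕ).choose m : ℝ))) =
      q ^ (m + 1) * (1 - (m + 1) / n) * (ν k * ((k : ℕ).choose (m + 1) : ℝ)) +
      q ^ (m + 1) * ((n - m) / n) * (ν k * ((k : ℕ).choose m : ℝ)) := fun k => by ring
  simp only [h2, Finset.sum_add_distrib, ← Finset.mul_sum] at h1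
  linear_combination h1

lemma IsCountStationary.sum_mul_choose {n : ℕ} (hn : n ≠ 0) {q : ℝ} (h0 : 0 ≤ q) (hq1 : q < 1)
    {ν : Fin (n + 1) → ℝ} (h : IsCountStationary n q ν) (m : ℕ) (hm : m ≤ n) :
    ∑ k, ν k * ((k : ℕ).choose m : ℝ) =
      ∏ j ∈ Finset.range m,
        (q ^ (j + 1) * ((n - j) / n)) / (1 - q ^ (j + 1) * (1 - (j + 1) / n)) := by
  induction m with
  | zero => simpa using h.1.2
  | succ m ih =>
    have h1 := h.sum_mul_choose_succ hn m
    have h2 := momentFactor_lt_one (m := m) (n := n) h0 hq1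
    rw [Finset.prod_range_succ, ← ih (by omega), ← mul_div_assoc,
      eq_div_iff (by linarith), h1, mul_comm]

lemma denomProd_one (n : ℕ) (q : ℝ) :
    denomProd n q 1 =
      ((∏ m ∈ Finset.range n, (1 - q ^ (m + 1) * (1 - (m + 1) / n)) : ℝ) : ℂ) := by
  simp [denomProd]

/-- Only $k=n$ contributes to the $n$-th binomial moment. -/
lemma IsCountStationary.apply_last {n : ℕ} (hn : n ≠ 0) {q : ℝ} (h0 : 0 ≤ q) (hq1 : q < 1)
    {ν : Fin (n + 1) → ℝ} (h : IsCountStationary n q ν) :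
    ν (Fin.last n) =
      fullMass n q / ∏ m ∈ Finset.range n, (1 - q ^ (m + 1) * (1 - (m + 1) / n)) := by
  have h1 := h.sum_mul_choose hn h0 hq1 n le_rfl
  rw [Finset.sum_eq_single (Fin.last n), Finset.prod_div_distrib, prod_momentRatio] at h1
  · simpa using h1
  · intro k _ hk
    have : (k : ℕ) < n := Fin.val_lt_last hk
    simp [Nat.choose_eq_zero_of_lt this]
  · simp

/-- Stationarity at $n$: the total inflow is $\nu(n)$, of which staying put accounts for
$q^n\nu(n)$. -/
lemma IsCountStationary.entryFlux_eq {n : ℕ} (hn : n ≠ 0) {q : ℝ}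
    {ν : Fin (n + 1) → ℝ} (h : IsCountStationary n q ν) :
    entryFlux n q ν = (1 - q ^ n) * ν (Fin.last n) := by
  have h1 := congrFun h.2 (Fin.last n)
  have hn' : (n : ℝ) ≠ 0 := by exact_mod_cast hn
  have h2 : countTransition n q (Fin.last n) (Fin.last n) = q ^ n := by
    simp [countTransition, binomialMass, hn']
  simp only [Matrix.vecMul, dotProduct] at h1
  rw [Fin.sum_univ_castSucc, h2] at h1
  unfold entryFlux
  linear_combination h1

lemma IsCountStationary.unique {n : ℕ} (hn : n ≠ 0) {q : ℝ} (h0 : 0 ≤ q) (hq1 : q < 1)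
    {ν ν' : Fin (n + 1) → ℝ} (h : IsCountStationary n q ν) (h' : IsCountStationary n q ν') :
    ν = ν' := by
  rw [← sub_eq_zero]
  refine eq_zero_of_sum_mul_choose_eq_zero _ fun m hm => ?_
  simp only [Pi.sub_apply, sub_mul, Finset.sum_sub_distrib]
  rw [h.sum_mul_choose hn h0 hq1 m hm, h'.sum_mul_choose hn h0 hq1 m hm, sub_self]

/-- A finite stochastic matrix has a stationary probability vector. -/
lemma exists_stationary {ι : Type*} [Fintype ι] [DecidableEq ι] [Nonempty ι] (P : Matrix ι ι ℝ)
    (h0 : ∀ i j, 0 ≤ P i j) (h1 : ∀ i, ∑ j, P i j = 1) :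
    ∃ ν ∈ stdSimplex ℝ ι, Matrix.vecMul ν P = ν := by
  -- Constants lie in the right kernel of $1-P$, so there is a nonzero left null vector $v$. Then
  -- $|v|\le|v|P$ entrywise with equal total mass, so equality holds and $|v|$ can be normalised.
  have hdet : (1 - P).det = 0 := by
    rw [← Matrix.exists_mulVec_eq_zero_iff]
    refine ⟨fun _ => 1, fun h => ?_, ?_⟩
    · simpa using congrFun h (Classical.arbitrary ι)
    · ext i
      rw [Matrix.sub_mulVec, Matrix.one_mulVec]
      simp [Matrix.mulVec, dotProduct, h1]
  obtain ⟨v, hv0, hv⟩ := Matrix.exists_vecMul_eq_zero_iff.2 hdet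
  have hv' : ∀ j, ∑ i, v i * P i j = v j := by
    intro j
    have := congrFun hv j
    simp only [Matrix.vecMul_sub, Matrix.vecMul_one, Pi.sub_apply, Pi.zero_apply, sub_eq_zero]
      at this
    exact this.symm
  have hle : ∀ j ∈ Finset.univ, |v j| ≤ ∑ i, |v i| * P i j := by
    intro j _
    rw [← hv' j]
    refine (Finset.abs_sum_le_sum_abs _ _).trans (Finset.sum_le_sum fun i _ => ?_)
    rw [abs_mul, abs_of_nonneg (h0 i j)]
  have hsum : ∑ j, |v j| = ∑ j, ∑ i, |v i| * P i j := by
    rw [Finset.sum_comm]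
    simp [← Finset.mul_sum, h1]
  have heq := (Finset.sum_eq_sum_iff_of_le hle).1 hsum
  have hpos : 0 < ∑ j, |v j| := by
    obtain ⟨i, hi⟩ := Function.ne_iff.1 hv0
    exact Finset.sum_pos' (fun _ _ => abs_nonneg _) ⟨i, Finset.mem_univ _, abs_pos.2 hi⟩
  refine ⟨fun i => |v i| / ∑ j, |v j|, ⟨fun i => by positivity, ?_⟩, ?_⟩
  · rw [← Finset.sum_div, div_self hpos.ne']
  · ext j
    simp only [Matrix.vecMul, dotProduct]
    rw [heq j (Finset.mem_univ _), Finset.sum_div]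
    exact Finset.sum_congr rfl fun i _ => by ring

lemma existsUnique_isCountStationary {n : ℕ} (hn : n ≠ 0) {q : ℝ} (h0 : 0 ≤ q) (h1 : q < 1) :
    ∃! ν : Fin (n + 1) → ℝ, IsCountStationary n q ν := by
  obtain ⟨ν, hν⟩ := exists_stationary (countTransition n q)
    (countTransition_nonneg h0 h1.le) (sum_countTransition hn q)
  exact ⟨ν, hν, fun ν' h' => IsCountStationary.unique hn h0 h1 h' hν⟩

/-! ### Hitting time of the full state: algebra of the killed chain -/

/-- Normalised binomial moments of the discounted occupation of the chain started at `n`,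
without the contribution of the stationary regime. -/
noncomputable def excursionMoment (n : ℕ) (q : ℝ) (z : ℂ) : ℕ → ℂ
  | 0 => 0
  | m + 1 => (1 + z * ((q ^ (m + 1) * ((m + 1) / n) : ℝ) : ℂ) * excursionMoment n q z m) /
      (1 - z * ((q ^ (m + 1) * (1 - (m + 1) / n) : ℝ) : ℂ))

/-- The constant $C=1/(1-q)$ reproduces itself in the recursion: with $b=q^{m+1}(m+1)/n$ the
denominator has norm at least $1-q^{m+1}+b$, and $1+bC\le C(1-q^{m+1}+b)$. The bound is uniform in
$n$, $m$ and $z$. -/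
lemma norm_excursionMoment_le {n : ℕ} {q : ℝ} (h0 : 0 ≤ q) (h1 : q < 1) {z : ℂ} (hz : ‖z‖ ≤ 1)
    (m : ℕ) (hm : m ≤ n) : ‖excursionMoment n q z m‖ ≤ 1 / (1 - q) := by
  have hq : 0 < 1 - q := by linarith
  induction m with
  | zero => simp [excursionMoment]; linarith
  | succ m ih =>
    have ih := ih (by omega)
    have hd := one_sub_le_norm (momentFactor_nonneg hm h0) hz
    have hlt := momentFactor_lt_one (m := m) (n := n) h0 h1
    rw [excursionMoment, norm_div, div_le_iff₀ (by linarith)]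
    set b : ℝ := q ^ (m + 1) * ((m + 1) / n) with hb
    have hb0 : 0 ≤ b := by positivity
    have hab : q ^ (m + 1) * (1 - (m + 1) / n : ℝ) = q ^ (m + 1) - b := by rw [hb]; ring
    have hnum : ‖1 + z * (b : ℂ) * excursionMoment n q z m‖ ≤ 1 + b * (1 / (1 - q)) := by
      refine (norm_add_le _ _).trans ?_
      rw [norm_one, norm_mul, norm_mul, Complex.norm_real, Real.norm_of_nonneg hb0]
      gcongr
      exact mul_le_of_le_one_left hb0 hz
    have hqm : q ^ (m + 1) ≤ q := pow_le_of_le_one h0 h1.le (by omega)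
    have h3 : 1 + b * (1 / (1 - q)) ≤ 1 / (1 - q) * (1 - (q ^ (m + 1) - b)) := by
      have : 1 ≤ 1 / (1 - q) * (1 - q ^ (m + 1)) := by
        rw [one_div, inv_mul_eq_div, le_div_iff₀ hq]; linarith
      linarith
    refine hnum.trans (h3.trans ?_)
    rw [hab] at hd ⊢
    gcongr

/-- At index $n$ the denominator is exactly $1$, and the previous moment enters with a factor of
norm at most $q^n$. -/
lemma norm_excursionMoment_self_sub_one_le {n : ℕ} (hn : n ≠ 0) {q : ℝ} (h0 : 0 ≤ q) (h1 : q < 1)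
    {z : ℂ} (hz : ‖z‖ ≤ 1) : ‖excursionMoment n q z n - 1‖ ≤ q ^ n / (1 - q) := by
  obtain ⟨m, rfl⟩ := Nat.exists_eq_succ_of_ne_zero hn
  have hm : ((m + 1 : ℕ) : ℝ) ≠ 0 := by positivity
  have h2 := norm_excursionMoment_le (n := m + 1) h0 h1 hz m (by omega)
  have h3 : ((m : ℝ) + 1) / ((m + 1 : ℕ) : ℝ) = 1 := by push_cast at hm ⊢; exact div_self hm
  rw [excursionMoment, h3, sub_self, mul_zero, Complex.ofReal_zero, mul_zero, sub_zero, div_one,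
    add_sub_cancel_left, mul_one, norm_mul, norm_mul, Complex.norm_real,
    Real.norm_of_nonneg (by positivity), div_eq_mul_one_div]
  gcongr
  exact mul_le_of_le_one_left (by positivity) hz

/-- The generating function of the hitting time of `n` is determined by the one-step equations of
the killed chain. -/
lemma hitting_identity {n : ℕ} (hn : n ≠ 0) {q : ℝ} (h0 : 0 ≤ q) (h1 : q < 1) {z : ℂ}
    (hz : ‖z‖ ≤ 1) (H : Fin (n + 1) → ℂ) (F : ℂ) (hlast : H (Fin.last n) = 0)
    (hH : ∀ l, H l + (if l = Fin.last n then F else 0) =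
      (if l = 0 then 1 else 0) + z * ∑ k, H k * (countTransition n q k l : ℂ)) :
    F * (z ^ n * fullMass n q + (1 - z) * excursionMoment n q z n * denomProd n q z) =
      z ^ n * fullMass n q := by
  have hmom : ∀ m : ℕ, (∑ l, H l * ((l : ℕ).choose m : ℂ)) + F * (n.choose m : ℂ) =
      (Nat.choose 0 m : ℂ) + z * ∑ k, H k *
        ((∑ l, countTransition n q k l * ((l : ℕ).choose m : ℝ) : ℝ) : ℂ) := by
    intro m
    have := Finset.sum_congr (rfl : (Finset.univ : Finset (Fin (n + 1))) = Finset.univ)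
      (fun l _ => congrArg (· * ((l : ℕ).choose m : ℂ)) (hH l))
    simp only [add_mul, ite_mul, zero_mul, one_mul, Finset.sum_add_distrib, Finset.sum_ite_eq',
      Finset.mem_univ, if_true, Fin.val_last, Fin.val_zero] at this
    rw [this]
    congr 1
    simp only [Complex.ofReal_sum, Complex.ofReal_mul, Complex.ofReal_natCast, Finset.mul_sum,
      Finset.sum_mul]
    rw [Finset.sum_comm]
    simp only [mul_assoc]
  have hn' : (n : ℂ) ≠ 0 := by exact_mod_cast hn
  -- Solution of the moment recursion: a multiple of the product solution started by the mass at
  -- $m=0$, minus the response to the source $F\binom nm$. Multiplying by $1-z$ avoids dividing by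
  -- it, so $z=1$ is allowed.
  have key : ∀ m ≤ n, (1 - z) * (∑ l, H l * ((l : ℕ).choose m : ℂ)) =
      (∏ j ∈ Finset.range m, (z * ((q ^ (j + 1) * ((n - j) / n) : ℝ) : ℂ)) /
        (1 - z * ((q ^ (j + 1) * (1 - (j + 1) / n) : ℝ) : ℂ))) * (1 - F) -
      F * (1 - z) * n.choose m * excursionMoment n q z m := by
    intro m hm
    induction m with
    | zero =>
      have := hmom 0
      simp only [Nat.choose_zero_right, Nat.cast_one, mul_one, sum_countTransition hn,
        Complex.ofReal_one] at this
      simp only [Nat.choose_zero_right, Nat.cast_one, mul_one, Finset.range_zero,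
        Finset.prod_empty, excursionMoment, mul_zero, sub_zero, one_mul]
      linear_combination this
    | succ m ih =>
      have ih := ih (by omega)
      have h2 := hmom (m + 1)
      simp only [sum_countTransition_mul_choose_succ hn] at h2
      have h3 : ∀ k : Fin (n + 1), H k * ((q ^ (m + 1) * ((1 - (m + 1) / n) *
            ((k : ℕ).choose (m + 1) : ℝ) + ((n : ℝ) - m) / n * ((k : ℕ).choose m : ℝ)) : ℝ) : ℂ) =
          ((q ^ (m + 1) * (1 - (m + 1) / n) : ℝ) : ℂ) * (H k * ((k : ℕ).choose (m + 1) : ℂ)) +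
          ((q ^ (m + 1) * ((n - m) / n) : ℝ) : ℂ) * (H k * ((k : ℕ).choose m : ℂ)) := by
        intro k; push_cast; ring
      simp only [h3, Finset.sum_add_distrib, ← Finset.mul_sum] at h2
      have hd := one_sub_momentFactor_ne_zero h0 h1 hm hz
      rw [Finset.prod_range_succ, excursionMoment]
      set d : ℂ := 1 - z * ((q ^ (m + 1) * (1 - (m + 1) / n) : ℝ) : ℂ) with hddef
      -- Converts the coefficient of the moment recursion into that of `excursionMoment`, whose
      -- entries are normalised by $\binom nm$.
      have hc : (n.choose (m + 1) : ℂ) * ((q ^ (m + 1) * ((m + 1) / n) : ℝ) : ℂ) =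
          ((q ^ (m + 1) * ((n - m) / n) : ℝ) : ℂ) * n.choose m := by
        have h4 := Nat.choose_succ_right_eq n m
        have h5 : (n.choose (m + 1) : ℂ) * (m + 1) = n.choose m * (n - m) := by
          rw [← Nat.cast_sub (by omega)]; exact_mod_cast h4
        push_cast
        field_simp
        linear_combination (q : ℂ) ^ (m + 1) * h5
      simp only [Nat.choose_zero_succ, Nat.cast_zero, zero_add] at h2
      set x := ∑ l, H l * ((l : ℕ).choose (m + 1) : ℂ)
      set y := ∑ l, H l * ((l : ℕ).choose m : ℂ)
      set E := ∏ j ∈ Finset.range m, (z * ((q ^ (j + 1) * ((n - j) / n) : ℝ) : ℂ)) /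
        (1 - z * ((q ^ (j + 1) * (1 - (j + 1) / n) : ℝ) : ℂ))
      set α : ℂ := ((q ^ (m + 1) * ((n - m) / n) : ℝ) : ℂ)
      set ρ := excursionMoment n q z m
      set β : ℂ := ((q ^ (m + 1) * ((m + 1) / n) : ℝ) : ℂ)
      have h6 : x * d = z * α * y - F * n.choose (m + 1) := by
        rw [hddef]; linear_combination h2
      have h7 : ((1 - z) * x) * d = (E * (z * α / d) * (1 - F) -
          F * (1 - z) * n.choose (m + 1) * ((1 + z * β * ρ) / d)) * d := by
        have e1 : (E * (z * α / d) * (1 - F) -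
          F * (1 - z) * n.choose (m + 1) * ((1 + z * β * ρ) / d)) * d =
          E * (z * α) * (1 - F) - F * (1 - z) * n.choose (m + 1) * (1 + z * β * ρ) := by
          field_simp
        rw [e1]
        linear_combination (1 - z) * h6 + z * α * ih + F * (1 - z) * z * ρ * hc
      exact mul_right_cancel₀ hd h7
  have hfin := key n le_rfl
  -- The killed occupation vanishes at $n$, the only state seen by the $n$-th moment; this
  -- determines $F$.
  have hz0 : ∑ l, H l * ((l : ℕ).choose n : ℂ) = 0 := by
    refine Finset.sum_eq_zero fun l _ => ?_
    rcases eq_or_ne l (Fin.last n) with rfl | hl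
    · rw [hlast, zero_mul]
    · rw [Nat.choose_eq_zero_of_lt (Fin.val_lt_last hl)]; simp
  have hD := denomProd_ne_zero (n := n) h0 h1 hz
  rw [hz0, mul_zero, Finset.prod_div_distrib, Finset.prod_mul_distrib, Finset.prod_const,
    Finset.card_range, ← Complex.ofReal_prod, prod_momentRatio, Nat.choose_self, Nat.cast_one,
    mul_one] at hfin
  change 0 = z ^ n * (fullMass n q : ℂ) / denomProd n q z * (1 - F) - _ at hfin
  field_simp at hfin
  linear_combination hfin

/-! ### From the rounds to the killed count chain -/

lemma measureReal_keep_eq {n : ℕ} (p : unitInterval) (S A : Finset (Fin n)) (hA : A ⊆ S) :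
    (Measure.pi fun _ : Fin n => bernoulliMeasure true false p).real
      {r | (S.filter fun i => r i = false) = A} =
      (1 - (p : ℝ)) ^ A.card * (p : ℝ) ^ (S.card - A.card) := by
  have hset : {r : Fin n → Bool | (S.filter fun i => r i = false) = A} =
      Set.univ.pi fun i => if i ∈ A then {false} else if i ∈ S then {true} else Set.univ := by
    ext r
    simp only [Set.mem_ofPred_eq, Set.mem_univ_pi, Finset.ext_iff, Finset.mem_filter]
    refine forall_congr' fun i => ?_
    by_cases h1 : i ∈ A
    · simp [h1, hA h1]
    · by_cases h2 : i ∈ S <;> simp [h1, h2]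
  rw [hset, measureReal_def, Measure.pi_pi, ENNReal.toReal_prod]
  have hfac : ∀ i, ((bernoulliMeasure true false p)
      (if i ∈ A then {false} else if i ∈ S then {true} else Set.univ)).toReal =
      if i ∈ S then (if i ∈ A then 1 - (p : ℝ) else p) else 1 := by
    intro i
    rw [← measureReal_def]
    by_cases h1 : i ∈ A
    · simp only [h1, hA h1, if_true]
      rw [bernoulliMeasure_real_apply_of_notMem_of_mem] <;> simp
    · by_cases h2 : i ∈ S
      · simp only [h1, h2, if_true, if_false]
        rw [bernoulliMeasure_real_apply_of_mem_of_notMem] <;> simp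
      · simp [h1, h2]
  simp only [hfac]
  rw [Finset.prod_ite_mem, Finset.univ_inter, Finset.prod_ite, Finset.prod_const,
    Finset.prod_const, Finset.filter_mem_eq_inter, Finset.inter_eq_right.2 hA,
    Finset.filter_not, Finset.filter_mem_eq_inter, Finset.inter_eq_right.2 hA,
    Finset.card_sdiff_of_subset hA]

lemma measureReal_card_keep_eq {n : ℕ} (p : unitInterval) (S : Finset (Fin n)) (l : ℕ) :
    (Measure.pi fun _ : Fin n => bernoulliMeasure true false p).real
      {r | (S.filter fun i => r i = false).card = l} = binomialMass S.card (1 - (p : ℝ)) l := by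
  have hset : {r : Fin n → Bool | (S.filter fun i => r i = false).card = l} =
      ⋃ A ∈ S.powersetCard l, {r | (S.filter fun i => r i = false) = A} := by
    ext r
    simp [Finset.mem_powersetCard]
  rw [hset, measureReal_biUnion_finset]
  · rw [Finset.sum_congr rfl fun A hA => by
      rw [measureReal_keep_eq p S A (Finset.mem_powersetCard.1 hA).1,
        (Finset.mem_powersetCard.1 hA).2]]
    rw [Finset.sum_const, Finset.card_powersetCard, binomialMass]
    simp [mul_assoc]
  · intro A _ B _ hAB
    rw [Function.onFun, Set.disjoint_left]
    intro r hr hr'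
    exact hAB (hr.symm.trans hr')
  · intro A _
    exact MeasurableSet.of_discrete

/-- From a held set of size `k`, the next count follows the transition rule of the count chain. -/
lemma roundLaw_card_step (n : ℕ) [NeZero n] (p : unitInterval) (S : Finset (Fin n))
    (k l : Fin (n + 1)) (hk : S.card = k) :
    (roundLaw n p).real {r | (step S r).card = l} = countTransition n (1 - (p : ℝ)) k l := by
  have hn : (n : ℝ) ≠ 0 := by exact_mod_cast NeZero.ne n
  have hset : {r : Round n | (step S r).card = l} =
      ⋃ i ∈ (Finset.univ : Finset (Fin n)), ({i} : Set (Fin n)) ×ˢ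
        {f : Fin n → Bool | ((insert i S).filter fun j => f j = false).card = l} := by
    ext ⟨i, f⟩
    simp [step]
  rw [hset, measureReal_biUnion_finset]
  · have hterm : ∀ i : Fin n, (roundLaw n p).real (({i} : Set (Fin n)) ×ˢ
        {f : Fin n → Bool | ((insert i S).filter fun j => f j = false).card = l}) =
        (n : ℝ)⁻¹ * binomialMass (insert i S).card (1 - (p : ℝ)) l := by
      intro i
      rw [roundLaw, measureReal_prod_prod, measureReal_card_keep_eq]
      congr 1
      rw [measureReal_def, PMF.toMeasure_apply_singleton _ _ (measurableSet_singleton i)]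
      simp
    simp only [hterm]
    rw [← Finset.mul_sum, ← Finset.sum_filter_add_sum_filter_not _ (· ∈ S)]
    rw [Finset.sum_congr rfl (g := fun _ => binomialMass k (1 - (p : ℝ)) l) fun i hi => by
        rw [Finset.insert_eq_of_mem (Finset.mem_filter.1 hi).2, hk],
      Finset.sum_congr rfl (s₁ := Finset.univ.filter (¬ · ∈ S))
        (g := fun _ => binomialMass (k + 1) (1 - (p : ℝ)) l) fun i hi => by
        rw [Finset.card_insert_of_notMem (Finset.mem_filter.1 hi).2, hk]]
    rw [Finset.sum_const, Finset.sum_const, Finset.filter_mem_eq_inter, Finset.univ_inter, hk,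
      Finset.filter_not, Finset.filter_mem_eq_inter, Finset.univ_inter,
      Finset.card_sdiff_of_subset (Finset.subset_univ _), Finset.card_univ, Fintype.card_fin, hk]
    simp only [countTransition, Matrix.of_apply, nsmul_eq_mul]
    rw [Nat.cast_sub (Nat.lt_succ_iff.1 k.2)]
    field_simp
  · intro i _ j _ hij
    rw [Function.onFun, Set.disjoint_left]
    rintro ⟨a, f⟩ ⟨ha, _⟩ ⟨ha', _⟩
    exact hij (ha.symm.trans ha')
  · intro i _
    exact MeasurableSet.of_discrete

lemma held_congr {n : ℕ} {ω ω' : ℕ → Round n} {t : ℕ} (h : ∀ r < t, ω r = ω' r) :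
    held ω t = held ω' t := by
  induction t with
  | zero => rfl
  | succ t ih =>
    rw [held, held, ih fun r hr => h r (by omega), h t (by omega)]

/-- The event that the set held at time `t` is `S` and the collection was never complete before. -/
def firstVisit {n : ℕ} (t : ℕ) (S : Finset (Fin n)) : Set (ℕ → Round n) :=
  {ω | held ω t = S ∧ ∀ r < t, held ω r ≠ Finset.univ}

lemma measurable_held {n : ℕ} (t : ℕ) : Measurable fun ω : ℕ → Round n => held ω t := by
  induction t with
  | zero => exact measurable_const
  | succ t ih =>
    exact (measurable_of_countable fun x : Finset (Fin n) × Round n => step x.1 x.2).comp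
      (ih.prodMk (measurable_pi_apply t))

lemma measurableSet_firstVisit {n : ℕ} (t : ℕ) (S : Finset (Fin n)) :
    MeasurableSet (firstVisit t S) := by
  have h : ∀ r (A : Finset (Fin n)), MeasurableSet {ω : ℕ → Round n | held ω r = A} :=
    fun r A => measurable_held r (measurableSet_singleton A)
  unfold firstVisit
  simp only [Set.ofPred_and, Set.ofPred_forall]
  exact (h t S).inter (MeasurableSet.iInter fun r => MeasurableSet.iInter fun _ =>
    (h r Finset.univ).compl)

/-- The Markov property: `firstVisit t S` depends only on the rounds with index below `t`, hence is
independent of round `t`. -/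
lemma measureReal_firstVisit_inter {n : ℕ} [NeZero n] (p : unitInterval) (t : ℕ)
    (S : Finset (Fin n)) (B : Set (Round n)) :
    (experiment n p).real (firstVisit t S ∩ {ω | ω t ∈ B}) =
      (experiment n p).real (firstVisit t S) * (roundLaw n p).real B := by
  -- Completes a finite history by arbitrary later rounds, which cannot influence the sets held up
  -- to time `t`.
  let ext (x : Finset.range t → Round n) : ℕ → Round n :=
    fun r => if h : r ∈ Finset.range t then x ⟨r, h⟩ else (0, fun _ => false)
  have hind := (iIndepFun_infinitePi (P := fun _ : ℕ => roundLaw n p)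
    (X := fun _ x => x) fun _ => measurable_id).indepFun_finset (Finset.range t) {t} (by simp)
    (fun i => measurable_pi_apply i)
  have h := hind.measure_inter_preimage_eq_mul {x | ext x ∈ firstVisit t S}
    {y | y ⟨t, by simp⟩ ∈ B} MeasurableSet.of_discrete MeasurableSet.of_discrete
  have h1 : (fun (a : ℕ → Round n) (i : Finset.range t) => a i) ⁻¹' {x | ext x ∈ firstVisit t S} =
      firstVisit t S := by
    ext ω
    have he : ∀ r ≤ t, held (ext fun i => ω i) r = held ω r := fun r hr =>
      held_congr fun r' hr' => by
        have : r' < t := by omega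
        simp [ext, this]
    simp only [Set.mem_preimage, Set.mem_ofPred_eq, firstVisit, he t le_rfl]
    refine and_congr_right fun _ => forall₂_congr fun r hr => by rw [he r hr.le]
  rw [h1] at h
  have h2 : Measure.infinitePi (fun _ : ℕ => roundLaw n p) {ω | ω t ∈ B} = roundLaw n p B :=
    (measurePreserving_eval_infinitePi (fun _ : ℕ => roundLaw n p) t).measure_preimage
      MeasurableSet.of_discrete.nullMeasurableSet
  have h3 := congrArg ENNReal.toReal h
  rw [ENNReal.toReal_mul] at h3
  simp only [measureReal_def, experiment]
  rw [← h2]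
  exact h3

/-- The probability that the count at time `t` is `k` and the collection was never complete
before. -/
noncomputable def firstVisitCount (n : ℕ) [NeZero n] (p : unitInterval) (t : ℕ)
    (k : Fin (n + 1)) : ℝ :=
  ∑ S : Finset (Fin n) with S.card = (k : ℕ), (experiment n p).real (firstVisit t S)

lemma pairwiseDisjoint_firstVisit {n : ℕ} (t : ℕ) (s : Set (Finset (Fin n))) :
    s.PairwiseDisjoint (firstVisit t) := by
  intro A _ B _ hAB
  rw [Function.onFun, Set.disjoint_left]
  intro r hr hr'
  exact hAB (hr.1.symm.trans hr'.1)

lemma firstVisitCount_eq {n : ℕ} [NeZero n] (p : unitInterval) (t : ℕ) (k : Fin (n + 1)) :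
    firstVisitCount n p t k = (experiment n p).real
      {ω | (held ω t).card = k ∧ ∀ r < t, held ω r ≠ Finset.univ} := by
  rw [firstVisitCount, ← measureReal_biUnion_finset (pairwiseDisjoint_firstVisit t _)
    fun S _ => measurableSet_firstVisit t S]
  congr 1
  ext ω
  simp [firstVisit]

lemma firstVisitCount_nonneg {n : ℕ} [NeZero n] (p : unitInterval) (t : ℕ) (k : Fin (n + 1)) :
    0 ≤ firstVisitCount n p t k := by
  rw [firstVisitCount_eq]; exact measureReal_nonneg

lemma firstVisitCount_le_one {n : ℕ} [NeZero n] (p : unitInterval) (t : ℕ) (k : Fin (n + 1)) :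
    firstVisitCount n p t k ≤ 1 := by
  rw [firstVisitCount_eq]; exact measureReal_le_one

lemma firstVisitCount_last {n : ℕ} [NeZero n] (p : unitInterval) (t : ℕ) :
    firstVisitCount n p t (Fin.last n) = (experiment n p).real (firstVisit t Finset.univ) := by
  rw [firstVisitCount_eq]
  congr 1
  ext ω
  have : (held ω t).card = n ↔ held ω t = Finset.univ := by
    rw [← Finset.card_eq_iff_eq_univ, Fintype.card_fin]
  simp [firstVisit, this]

lemma firstVisitCount_zero {n : ℕ} [NeZero n] (p : unitInterval) (k : Fin (n + 1)) :
    firstVisitCount n p 0 k = if k = 0 then 1 else 0 := by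
  rw [firstVisitCount_eq]
  rcases eq_or_ne k 0 with rfl | hk
  · simp [held]
  · have : ¬ (0 = (k : ℕ)) := fun h => hk (Fin.ext h.symm)
    simp [held, hk, this]

/-- The forward equation of the killed chain: mass that has reached $n$ is not propagated, so the
entry at $n$ is $\mathbb P(T=t)$ and the other entries describe $T>t$. -/
lemma firstVisitCount_succ {n : ℕ} [NeZero n] (p : unitInterval) (t : ℕ) (l : Fin (n + 1)) :
    firstVisitCount n p (t + 1) l =
      ∑ k, (if k = Fin.last n then 0 else firstVisitCount n p t k) *
        countTransition n (1 - (p : ℝ)) k l := by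
  have hset : {ω : ℕ → Round n | (held ω (t + 1)).card = l ∧
      ∀ r < t + 1, held ω r ≠ Finset.univ} =
      ⋃ S ∈ Finset.univ.filter fun S : Finset (Fin n) => S ≠ Finset.univ,
        (firstVisit t S ∩ {ω | ω t ∈ {r | (step S r).card = l}}) := by
    ext ω
    simp only [Set.mem_ofPred_eq, Set.mem_iUnion, Finset.mem_filter, Finset.mem_univ, true_and,
      Set.mem_inter_iff, firstVisit, held, exists_prop]
    constructor
    · rintro ⟨h1, h2⟩
      exact ⟨held ω t, h2 t (by omega), ⟨rfl, fun r hr => h2 r (by omega)⟩, h1⟩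
    · rintro ⟨S, hS, ⟨rfl, h2⟩, h1⟩
      refine ⟨h1, fun r hr => ?_⟩
      rcases (Nat.lt_succ_iff.1 hr).lt_or_eq with h | rfl
      · exact h2 r h
      · exact hS
  rw [firstVisitCount_eq, hset, measureReal_biUnion_finset]
  · have hcard : ∀ S : Finset (Fin n), S.card < n + 1 := fun S =>
      Nat.lt_succ_iff.2 ((Finset.card_le_univ S).trans_eq (Fintype.card_fin n))
    rw [Finset.sum_congr rfl fun S _ => by
      rw [measureReal_firstVisit_inter, roundLaw_card_step n p S ⟨S.card, hcard S⟩ l rfl]]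
    rw [← Finset.sum_fiberwise _ fun S : Finset (Fin n) => (⟨S.card, hcard S⟩ : Fin (n + 1))]
    refine Finset.sum_congr rfl fun k _ => ?_
    rw [Finset.sum_congr rfl fun S hS => by rw [(Finset.mem_filter.1 hS).2], ← Finset.sum_mul]
    congr 1
    have hlast : ∀ S : Finset (Fin n), S = Finset.univ ↔ S.card = n := fun S => by
      rw [← Finset.card_eq_iff_eq_univ, Fintype.card_fin]
    rw [Finset.filter_filter]
    split_ifs with hk
    · subst hk
      rw [Finset.filter_false_of_mem, Finset.sum_empty]
      rintro S _ ⟨h1, h2⟩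
      exact h1 ((hlast S).2 (congrArg Fin.val h2))
    · rw [firstVisitCount]
      congr 1
      ext S
      simp only [Finset.mem_filter, Finset.mem_univ, true_and, Fin.ext_iff, and_iff_right_iff_imp]
      intro h hS
      exact hk (Fin.ext (h.symm.trans ((hlast S).1 hS)))
  · intro A _ B _ hAB
    exact (pairwiseDisjoint_firstVisit t Set.univ (Set.mem_univ A) (Set.mem_univ B) hAB).mono
      Set.inter_subset_left Set.inter_subset_left
  · intro S _
    exact (measurableSet_firstVisit t S).inter
      (measurable_pi_apply t MeasurableSet.of_discrete)

/-! ### The completion time and its generating function -/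

lemma completionTime_eq_coe_iff {n : ℕ} (ω : ℕ → Round n) (t : ℕ) :
    completionTime ω = t ↔ ω ∈ firstVisit t Finset.univ := by
  constructor
  · intro h
    have hlt : ∀ r < t, held ω r ≠ Finset.univ := by
      intro r hr hu
      have : completionTime ω ≤ r := iInf₂_le r hu
      rw [h] at this
      exact absurd (Nat.cast_le.1 this) (by omega)
    refine ⟨?_, hlt⟩
    by_contra hne
    have : ((t + 1 : ℕ) : ℕ∞) ≤ completionTime ω := by
      refine le_iInf₂ fun r hr => Nat.cast_le.2 ?_
      by_contra hlt'
      rcases (Nat.lt_succ_iff.1 (not_le.1 hlt')).lt_or_eq with h' | rfl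
      · exact hlt r h' hr
      · exact hne hr
    rw [h] at this
    exact absurd (Nat.cast_le.1 this) (by omega)
  · rintro ⟨h1, h2⟩
    refine le_antisymm (iInf₂_le t h1) (le_iInf₂ fun r hr => Nat.cast_le.2 ?_)
    by_contra hlt
    exact h2 r (not_le.1 hlt) hr

lemma completionTime_ne_top_eq_iUnion {n : ℕ} :
    {ω : ℕ → Round n | completionTime ω ≠ ⊤} =
      ⋃ t : ℕ, firstVisit t Finset.univ := by
  ext ω
  simp only [Set.mem_ofPred_eq, Set.mem_iUnion, ← completionTime_eq_coe_iff,
    ENat.ne_top_iff_exists, eq_comm]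

lemma measurable_completionTime_toNat {n : ℕ} :
    Measurable fun ω : ℕ → Round n => (completionTime ω).toNat := by
  have h : ∀ t : ℕ, MeasurableSet {ω : ℕ → Round n | completionTime ω = t} := fun t => by
    simp only [completionTime_eq_coe_iff]
    exact measurableSet_firstVisit t _
  have htop : MeasurableSet {ω : ℕ → Round n | completionTime ω = ⊤} := by
    have := (MeasurableSet.iUnion fun t : ℕ =>
      measurableSet_firstVisit t (Finset.univ : Finset (Fin n))).compl
    rw [← completionTime_ne_top_eq_iUnion] at this
    simpa [Set.compl_def] using this
  refine measurable_to_countable' fun t => ?_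
  -- Since `toNat` sends `⊤` to `0`, the fibre over `0` also contains the event of no completion.
  have : (fun ω : ℕ → Round n => (completionTime ω).toNat) ⁻¹' {t} =
      {ω | completionTime ω = t} ∪ {ω | t = 0 ∧ completionTime ω = ⊤} := by
    ext ω
    simp only [Set.mem_preimage, Set.mem_singleton_iff, Set.mem_union, Set.mem_ofPred_eq]
    rcases eq_or_ne (completionTime ω) ⊤ with h | h
    · simp [h, eq_comm]
    · obtain ⟨s, hs⟩ := ENat.ne_top_iff_exists.1 h
      simp [← hs]
  rw [this]
  refine (h t).union ?_
  by_cases ht : t = 0 <;> simp [ht, htop]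

lemma firstVisit_univ_disjoint {n : ℕ} :
    Pairwise (Function.onFun Disjoint
      fun t : ℕ => firstVisit t (Finset.univ : Finset (Fin n))) := by
  intro s t hst
  rw [Function.onFun, Set.disjoint_left]
  intro ω hs ht
  rw [← completionTime_eq_coe_iff] at hs ht
  exact hst (Nat.cast_injective (hs.symm.trans ht))

lemma hasSum_firstVisitCount_last {n : ℕ} [NeZero n] (p : unitInterval) :
    HasSum (fun t => firstVisitCount n p t (Fin.last n))
      ((experiment n p).real {ω | completionTime ω ≠ ⊤}) := by
  have hU : experiment n p (⋃ t : ℕ, firstVisit t Finset.univ) ≠ ⊤ := measure_ne_top _ _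
  rw [measure_iUnion firstVisit_univ_disjoint fun t => measurableSet_firstVisit t _] at hU
  have h := ENNReal.hasSum_toReal hU
  rw [completionTime_ne_top_eq_iUnion, measureReal_def,
    measure_iUnion firstVisit_univ_disjoint fun t => measurableSet_firstVisit t _,
    ENNReal.tsum_toReal_eq (ENNReal.ne_top_of_tsum_ne_top hU)]
  simpa only [firstVisitCount_last, measureReal_def] using h

/-- The generating function of the completion time. -/
noncomputable def completionGF (n : ℕ) [NeZero n] (p : unitInterval) (z : ℂ) : ℂ :=
  ∑' t, (firstVisitCount n p t (Fin.last n) : ℂ) * z ^ t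

lemma continuousOn_completionGF (n : ℕ) [NeZero n] (p : unitInterval) :
    ContinuousOn (completionGF n p) (Metric.closedBall 0 1) := by
  refine continuousOn_tsum (u := fun t => firstVisitCount n p t (Fin.last n))
    (fun t => by fun_prop) (hasSum_firstVisitCount_last p).summable fun t z hz => ?_
  have hz' : ‖z‖ ≤ 1 := by simpa using hz
  rw [norm_mul, norm_pow, Complex.norm_real, Real.norm_of_nonneg (firstVisitCount_nonneg p t _)]
  exact mul_le_of_le_one_right (firstVisitCount_nonneg p t _) (pow_le_one₀ (norm_nonneg _) hz')

lemma continuousOn_excursionMoment {n : ℕ} {q : ℝ} (h0 : 0 ≤ q) (h1 : q < 1) (m : ℕ)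
    (hm : m ≤ n) :
    ContinuousOn (fun z => excursionMoment n q z m) (Metric.closedBall 0 1) := by
  induction m with
  | zero => exact continuousOn_const
  | succ m ih =>
    have ih := ih (by omega)
    simp only [excursionMoment]
    refine ContinuousOn.div (by fun_prop) (by fun_prop) fun z hz => ?_
    exact one_sub_momentFactor_ne_zero h0 h1 hm (by simpa using hz)

lemma continuous_denomProd (n : ℕ) (q : ℝ) : Continuous (denomProd n q) := by
  unfold denomProd
  fun_prop

/-- Inside the open disc all occupation series converge by comparison with a geometric series,
before finiteness of $T$ is known. -/
lemma completionGF_identity_of_norm_lt_one (n : ℕ) [NeZero n] (p : unitInterval) (hp : 0 < p)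
    {z : ℂ} (hz : ‖z‖ < 1) :
    completionGF n p z * (z ^ n * fullMass n (1 - p) +
      (1 - z) * excursionMoment n (1 - p) z n * denomProd n (1 - p) z) =
      z ^ n * fullMass n (1 - p) := by
  have hp0 : (0 : ℝ) < p := hp
  have hp1 : (p : ℝ) ≤ 1 := p.2.2
  obtain ⟨G, hGdef⟩ : ∃ G : Fin (n + 1) → ℂ,
      ∀ k, G k = ∑' t, (firstVisitCount n p t k : ℂ) * z ^ t := ⟨_, fun _ => rfl⟩
  have hG : ∀ k, HasSum (fun t => (firstVisitCount n p t k : ℂ) * z ^ t) (G k) := fun k => by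
    rw [hGdef]
    refine (Summable.of_norm_bounded (summable_geometric_of_lt_one (norm_nonneg z) hz)
      fun t => ?_).hasSum
    rw [norm_mul, norm_pow, Complex.norm_real, Real.norm_of_nonneg (firstVisitCount_nonneg p t _)]
    exact mul_le_of_le_one_left (by positivity) (firstVisitCount_le_one p t _)
  refine hitting_identity (NeZero.ne n) (by linarith) (by linarith) hz.le
    (fun k => if k = Fin.last n then 0 else G k) _ (by simp) fun l => ?_
  have h1 : HasSum (fun t => (firstVisitCount n p (t + 1) l : ℂ) * z ^ (t + 1))
      (z * ∑ k, (if k = Fin.last n then 0 else G k) *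
        (countTransition n (1 - (p : ℝ)) k l : ℂ)) := by
    have h2 : HasSum (fun t => ∑ k, (if k = Fin.last n then 0 else
        (firstVisitCount n p t k : ℂ) * z ^ t) * (countTransition n (1 - (p : ℝ)) k l : ℂ))
        (∑ k, (if k = Fin.last n then 0 else G k) *
          (countTransition n (1 - (p : ℝ)) k l : ℂ)) := by
      refine hasSum_sum fun k _ => HasSum.mul_right _ ?_
      split_ifs
      · exact hasSum_zero
      · exact hG k
    have heq : (fun t => (firstVisitCount n p (t + 1) l : ℂ) * z ^ (t + 1)) =
        fun t => z * ∑ k, (if k = Fin.last n then 0 else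
        (firstVisitCount n p t k : ℂ) * z ^ t) * (countTransition n (1 - (p : ℝ)) k l : ℂ) := by
      funext t
      rw [firstVisitCount_succ, Complex.ofReal_sum, Finset.sum_mul, Finset.mul_sum]
      refine Finset.sum_congr rfl fun k _ => ?_
      split_ifs
      · simp
      · push_cast; ring
    rw [heq]
    exact h2.mul_left z
  have h3 := (hG l).unique
    (HasSum.zero_add (f := fun t => (firstVisitCount n p t l : ℂ) * z ^ t) h1)
  rw [firstVisitCount_zero] at h3
  have h4 : ((if l = Fin.last n then 0 else G l) +
      if l = Fin.last n then completionGF n p z else 0) = G l := by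
    split_ifs with h
    · rw [h]; rw [hGdef, completionGF, zero_add]
    · simp
  rw [h4, h3]
  congr 1
  split_ifs <;> simp

/-- Both sides are continuous on the closed disc, because the coefficients of the generating
function are summable. -/
lemma completionGF_identity (n : ℕ) [NeZero n] (p : unitInterval) (hp : 0 < p)
    {z : ℂ} (hz : ‖z‖ ≤ 1) :
    completionGF n p z * (z ^ n * fullMass n (1 - p) +
      (1 - z) * excursionMoment n (1 - p) z n * denomProd n (1 - p) z) =
      z ^ n * fullMass n (1 - p) := by
  have hp0 : (0 : ℝ) < p := hp
  have hp1 : (p : ℝ) ≤ 1 := p.2.2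
  have h := Set.EqOn.of_subset_closure (s := Metric.ball (0 : ℂ) 1)
    (t := Metric.closedBall (0 : ℂ) 1)
    (f := fun z => completionGF n p z * (z ^ n * fullMass n (1 - p) +
      (1 - z) * excursionMoment n (1 - p) z n * denomProd n (1 - p) z))
    (g := fun z => z ^ n * fullMass n (1 - p))
    (fun z hz => completionGF_identity_of_norm_lt_one n p hp (by simpa using hz)) ?_ ?_
    Metric.ball_subset_closedBall (by rw [closure_ball _ one_ne_zero])
  · exact h (by simpa using hz)
  · have e1 := continuousOn_completionGF n p
    have e2 := continuousOn_excursionMoment (n := n) (q := 1 - p) (by linarith) (by linarith) n le_rfl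
    have e3 := (continuous_denomProd n (1 - p)).continuousOn (s := Metric.closedBall 0 1)
    fun_prop
  · fun_prop

lemma ae_completionTime_ne_top (n : ℕ) [NeZero n] (p : unitInterval) (hp : 0 < p) (hp1 : p < 1) :
    ∀ᵐ ω ∂(experiment n p), completionTime ω ≠ ⊤ := by
  have hq : (0 : ℝ) < 1 - p := sub_pos.2 hp1
  have h := completionGF_identity n p hp (z := 1) (by simp)
  have hpos : (fullMass n (1 - p) : ℂ) ≠ 0 :=
    Complex.ofReal_ne_zero.2 (fullMass_pos (NeZero.ne n) hq).ne'
  simp only [one_pow, one_mul, sub_self, zero_mul, add_zero] at h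
  have h1 : completionGF n p 1 = 1 := mul_right_cancel₀ hpos (h.trans (one_mul _).symm)
  have h2 := (Complex.hasSum_ofReal.2 (hasSum_firstVisitCount_last (n := n) p)).tsum_eq
  simp only [completionGF, one_pow, mul_one] at h1
  rw [h1] at h2
  have h3 : (experiment n p).real {ω | completionTime ω ≠ ⊤} = 1 := by exact_mod_cast h2.symm
  have hm : MeasurableSet {ω : ℕ → Round n | completionTime ω ≠ ⊤} := by
    rw [completionTime_ne_top_eq_iUnion]
    exact MeasurableSet.iUnion fun t => measurableSet_firstVisit t _
  exact (mem_ae_iff_prob_eq_one hm).2 ((ENNReal.toReal_eq_one_iff _).1 h3)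

lemma charFun_map_completionTime (n : ℕ) [NeZero n] (p : unitInterval) (hp : 0 < p) (hp1 : p < 1)
    (c s : ℝ) :
    charFun ((experiment n p).map fun ω => c * ((completionTime ω).toNat : ℝ)) s =
      completionGF n p (Complex.exp ((s * c : ℝ) * Complex.I)) := by
  have hN := measurable_completionTime_toNat (n := n)
  have hcN : Measurable fun ω : ℕ → Round n => c * ((completionTime ω).toNat : ℝ) :=
    (measurable_of_countable fun k : ℕ => c * (k : ℝ)).comp hN
  rw [charFun_apply_real, integral_map hcN.aemeasurable (by fun_prop)]
  have hmap := integral_map (μ := experiment n p) hN.aemeasurable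
    (f := fun k : ℕ => Complex.exp (s * (c * k : ℝ) * Complex.I))
    (measurable_of_countable _).aestronglyMeasurable
  rw [← hmap]
  have : IsProbabilityMeasure ((experiment n p).map fun ω => (completionTime ω).toNat) :=
    Measure.isProbabilityMeasure_map hN.aemeasurable
  rw [integral_countable]
  · refine tsum_congr fun k => ?_
    rw [map_measureReal_apply hN (measurableSet_singleton k), firstVisitCount_last,
      ← Complex.exp_nat_mul, Complex.real_smul]
    congr 2
    · refine measureReal_congr ?_
      -- Almost sure finiteness is what identifies `toNat = k` with $T=k$, notably for $k=0$.
      filter_upwards [ae_completionTime_ne_top n p hp hp1] with ω hω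
      obtain ⟨t, ht⟩ := ENat.ne_top_iff_exists.1 hω
      apply propext
      change (completionTime ω).toNat = k ↔ ω ∈ firstVisit k Finset.univ
      rw [← completionTime_eq_coe_iff, ← ht]
      simp
    · push_cast; ring
  · refine Integrable.of_bound (measurable_of_countable _).aestronglyMeasurable 1
      (Eventually.of_forall fun k => ?_)
    rw [← Complex.ofReal_mul, Complex.norm_exp_ofReal_mul_I]

/-! ### Limits as the number of types grows -/

lemma charFun_expMeasure_one (s : ℝ) : charFun (expMeasure 1) s = 1 / (1 - s * Complex.I) := by
  rw [charFun_apply_real, expMeasure, gammaMeasure,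
    integral_withDensity_eq_integral_toReal_smul (f := gammaPDF 1 1)
      (measurable_gammaPDFReal 1 1).ennreal_ofReal
      (Eventually.of_forall fun x => by simp [gammaPDF])]
  have h : ∀ x : ℝ, (gammaPDF 1 1 x).toReal • Complex.exp (s * x * Complex.I) =
      (Set.Ici (0 : ℝ)).indicator (fun x : ℝ => Complex.exp ((s * Complex.I - 1) * x)) x := by
    intro x
    by_cases hx : 0 ≤ x
    · rw [Set.indicator_of_mem (by exact hx), gammaPDF_of_nonneg hx,
        ENNReal.toReal_ofReal (by simp; positivity)]
      simp only [Real.one_rpow, Real.Gamma_one, sub_self, Real.rpow_zero, Complex.real_smul]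
      push_cast
      rw [div_one, one_mul, one_mul, ← Complex.exp_add]
      congr 1
      ring
    · rw [Set.indicator_of_notMem (by exact hx), gammaPDF_of_neg (not_le.1 hx)]
      simp
  simp only [h]
  rw [integral_indicator measurableSet_Ici, integral_Ici_eq_integral_Ioi,
    integral_exp_mul_complex_Ioi (by simp)]
  have h2 : (1 : ℂ) - s * Complex.I ≠ 0 := fun h => by simpa using congrArg Complex.re h
  have h3 : (s : ℂ) * Complex.I - 1 ≠ 0 := fun h => by simpa using congrArg Complex.re h
  simp only [Complex.ofReal_zero, mul_zero, Complex.exp_zero]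
  field_simp
  ring

lemma ofReal_qProd {q : ℝ} (h0 : 0 ≤ q) (h1 : q < 1) :
    (qProd q : ℂ) = ∏' r : ℕ, (1 + -((q ^ (r + 1) : ℝ) : ℂ)) := by
  have hs : Summable fun r : ℕ => q ^ (r + 1) :=
    (summable_nat_add_iff 1).2 (summable_geometric_of_lt_one h0 h1)
  have hm : Multipliable fun r : ℕ => (1 - q ^ (r + 1)) := by
    simp only [sub_eq_add_neg]
    refine multipliable_one_add_of_summable ?_
    simpa [abs_of_nonneg h0] using hs
  have := hm.map_tprod Complex.ofRealHom Complex.continuous_ofReal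
  rw [qProd]
  simpa [sub_eq_add_neg] using this

lemma qProd_ne_zero {q : ℝ} (h0 : 0 ≤ q) (h1 : q < 1) : qProd q ≠ 0 := by
  have hs : Summable fun r : ℕ => q ^ (r + 1) :=
    (summable_nat_add_iff 1).2 (summable_geometric_of_lt_one h0 h1)
  rw [qProd]
  simp only [sub_eq_add_neg]
  refine tprod_one_add_ne_zero_of_summable (fun r => ?_) ?_
  · have := pow_lt_one₀ h0 h1 (by omega : r + 1 ≠ 0)
    intro h
    rw [← sub_eq_add_neg] at h
    exact this.ne (by linarith)
  · simpa [abs_of_nonneg h0] using hs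

/-- Dominated convergence for infinite products: factors beyond $n$ are set to $1$, and the
deviations from $1$ are bounded by $q^{m+1}$. -/
lemma tendsto_denomProd {q : ℝ} (h0 : 0 ≤ q) (h1 : q < 1) {z : ℕ → ℂ} (hz : ∀ n, ‖z n‖ ≤ 1)
    (hz1 : Tendsto z atTop (𝓝 1)) :
    Tendsto (fun n => denomProd n q (z n)) atTop (𝓝 (qProd q : ℂ)) := by
  have hs : Summable fun r : ℕ => q ^ (r + 1) :=
    (summable_nat_add_iff 1).2 (summable_geometric_of_lt_one h0 h1)
  have hprod : ∀ n, denomProd n q (z n) = ∏' m : ℕ, (1 + if m < n then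
      -(z n * ((q ^ (m + 1) * (1 - (m + 1) / n) : ℝ) : ℂ)) else 0) := by
    intro n
    rw [tprod_eq_prod (s := Finset.range n) fun m hm => by
      rw [if_neg (by simpa using hm), add_zero], denomProd]
    exact Finset.prod_congr rfl fun m hm => by
      rw [if_pos (Finset.mem_range.1 hm), sub_eq_add_neg]
  simp only [hprod]
  rw [ofReal_qProd h0 h1]
  refine tendsto_tprod_one_add_of_dominated_convergence hs (fun m => ?_)
    (Eventually.of_forall fun n m => ?_)
  · have h2 : Tendsto (fun n : ℕ => ((m : ℝ) + 1) / n) atTop (𝓝 0) :=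
      tendsto_const_div_atTop_nhds_zero_nat _
    have h3 : Tendsto (fun n : ℕ => q ^ (m + 1) * (1 - ((m : ℝ) + 1) / n)) atTop
        (𝓝 (q ^ (m + 1))) := by
      simpa using (tendsto_const_nhds (x := q ^ (m + 1))).mul (h2.const_sub 1)
    have h4 : Tendsto (fun n : ℕ => -(z n * ((q ^ (m + 1) * (1 - (m + 1) / n) : ℝ) : ℂ))) atTop
        (𝓝 (-((q ^ (m + 1) : ℝ) : ℂ))) := by
      simpa only [one_mul, Function.comp_def] using
        (hz1.mul ((Complex.continuous_ofReal.tendsto _).comp h3)).neg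
    refine h4.congr' ?_
    filter_upwards [eventually_gt_atTop m] with n hn
    rw [if_pos hn]
  · split_ifs with hm
    · have h5 := momentFactor_nonneg hm h0
      rw [norm_neg, norm_mul, Complex.norm_real, Real.norm_of_nonneg h5]
      exact (mul_le_of_le_one_left h5 (hz n)).trans (momentFactor_le h0)
    · simp; positivity

/-- The factor $n$ is needed for $z^n\to1$ at $z=e^{is\mu_n}$; the crude bound $f_n\le q^n$
suffices. -/
lemma tendsto_nat_mul_fullMass {q : ℝ} (h0 : 0 < q) (h1 : q < 1) :
    Tendsto (fun n : ℕ => n * fullMass n q) atTop (𝓝 0) := by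
  refine squeeze_zero' (Eventually.of_forall fun n => by unfold fullMass; positivity) ?_
    (tendsto_self_mul_const_pow_of_lt_one h0.le h1)
  filter_upwards [eventually_ge_atTop 1] with n hn
  have e1 : (n.factorial : ℝ) / (n : ℝ) ^ n ≤ 1 := by
    refine div_le_one_of_le₀ ?_ (by positivity)
    exact_mod_cast Nat.factorial_le_pow n
  have e2 : q ^ (n * (n + 1) / 2) ≤ q ^ n := by
    refine pow_le_pow_of_le_one h0.le h1.le ?_
    rw [Nat.le_div_iff_mul_le two_pos]
    exact Nat.mul_le_mul_left n (by omega)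
  unfold fullMass
  gcongr
  exact (mul_le_of_le_one_left (by positivity) e1).trans e2

lemma fullMass_div_entryFlux_eventuallyEq {q : ℝ} (h0 : 0 < q) (h1 : q < 1)
    {ν : (n : ℕ) → Fin (n + 1) → ℝ} (hν : ∀ n : ℕ, 1 ≤ n → IsCountStationary n q (ν n)) :
    (fun n : ℕ => ((fullMass n q / entryFlux n q (ν n) : ℝ) : ℂ)) =ᶠ[atTop]
      fun n => denomProd n q 1 / ((1 - q ^ n : ℝ) : ℂ) := by
  filter_upwards [eventually_ge_atTop 1] with n hn
  have hn0 : n ≠ 0 := by omega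
  have hf := (fullMass_pos hn0 h0).ne'
  rw [(hν n hn).entryFlux_eq hn0, (hν n hn).apply_last hn0 h0.le h1, denomProd_one,
    ← Complex.ofReal_div]
  congr 1
  field_simp

lemma entryFlux_pos {q : ℝ} (h0 : 0 < q) (h1 : q < 1)
    {ν : (n : ℕ) → Fin (n + 1) → ℝ} (hν : ∀ n : ℕ, 1 ≤ n → IsCountStationary n q (ν n))
    {n : ℕ} (hn : 1 ≤ n) : 0 < entryFlux n q (ν n) := by
  have hn0 : n ≠ 0 := by omega
  rw [(hν n hn).entryFlux_eq hn0, (hν n hn).apply_last hn0 h0.le h1]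
  refine mul_pos (sub_pos.2 (pow_lt_one₀ h0.le h1 hn0)) (div_pos (fullMass_pos hn0 h0) ?_)
  exact Finset.prod_pos fun m _ => sub_pos.2 (momentFactor_lt_one h0.le h1)

lemma tendsto_fullMass_div_entryFlux {q : ℝ} (h0 : 0 < q) (h1 : q < 1)
    {ν : (n : ℕ) → Fin (n + 1) → ℝ} (hν : ∀ n : ℕ, 1 ≤ n → IsCountStationary n q (ν n)) :
    Tendsto (fun n : ℕ => fullMass n q / entryFlux n q (ν n)) atTop (𝓝 (qProd q)) := by
  have h : Tendsto (fun n : ℕ => ((fullMass n q / entryFlux n q (ν n) : ℝ) : ℂ)) atTop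
      (𝓝 (qProd q : ℂ)) := by
    refine Tendsto.congr' (fullMass_div_entryFlux_eventuallyEq h0 h1 hν).symm ?_
    have e1 : Tendsto (fun n : ℕ => ((1 - q ^ n : ℝ) : ℂ)) atTop (𝓝 ((1 : ℝ) : ℂ)) := by
      refine (Complex.continuous_ofReal.tendsto _).comp ?_
      simpa using (tendsto_pow_atTop_nhds_zero_of_lt_one h0.le h1).const_sub 1
    have e2 := (tendsto_denomProd h0.le h1 (z := fun _ => 1) (by simp) tendsto_const_nhds).div e1
      (by simp)
    rwa [Complex.ofReal_one, div_one] at e2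
  exact_mod_cast (Complex.continuous_re.tendsto _).comp h

lemma entryFlux_isEquivalent {q : ℝ} (h0 : 0 < q) (h1 : q < 1)
    {ν : (n : ℕ) → Fin (n + 1) → ℝ} (hν : ∀ n : ℕ, 1 ≤ n → IsCountStationary n q (ν n)) :
    Asymptotics.IsEquivalent atTop (fun n : ℕ => entryFlux n q (ν n))
      (fun n : ℕ => 1 / qProd q * ((n.factorial : ℝ) / (n : ℝ) ^ n) * q ^ (n * (n + 1) / 2)) := by
  have hQ := qProd_ne_zero h0.le h1
  refine Asymptotics.IsEquivalent.symm (Asymptotics.isEquivalent_of_tendsto_one ?_)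
  have h := (tendsto_fullMass_div_entryFlux h0 h1 hν).div_const (qProd q)
  rw [div_self hQ] at h
  refine h.congr fun n => ?_
  simp only [Pi.div_apply, fullMass]
  ring

lemma tendsto_nat_mul_entryFlux {q : ℝ} (h0 : 0 < q) (h1 : q < 1)
    {ν : (n : ℕ) → Fin (n + 1) → ℝ} (hν : ∀ n : ℕ, 1 ≤ n → IsCountStationary n q (ν n)) :
    Tendsto (fun n : ℕ => n * entryFlux n q (ν n)) atTop (𝓝 0) := by
  have h := (tendsto_nat_mul_fullMass h0 h1).div (tendsto_fullMass_div_entryFlux h0 h1 hν)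
    (qProd_ne_zero h0.le h1)
  rw [zero_div] at h
  refine h.congr' ?_
  filter_upwards [eventually_ge_atTop 1] with n hn
  have := (fullMass_pos (by omega : n ≠ 0) h0).ne'
  have := (entryFlux_pos h0 h1 hν hn).ne'
  simp only [Pi.div_apply]
  field_simp

lemma tendsto_entryFlux {q : ℝ} (h0 : 0 < q) (h1 : q < 1)
    {ν : (n : ℕ) → Fin (n + 1) → ℝ} (hν : ∀ n : ℕ, 1 ≤ n → IsCountStationary n q (ν n)) :
    Tendsto (fun n : ℕ => entryFlux n q (ν n)) atTop (𝓝 0) := by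
  refine squeeze_zero' ?_ ?_ (tendsto_nat_mul_entryFlux h0 h1 hν)
  · filter_upwards [eventually_ge_atTop 1] with n hn
    exact (entryFlux_pos h0 h1 hν hn).le
  · filter_upwards [eventually_ge_atTop 1] with n hn
    exact le_mul_of_one_le_left (entryFlux_pos h0 h1 hν hn).le (by exact_mod_cast hn)

lemma tendsto_ratio_completionGF {q : ℝ} (h0 : 0 < q) (h1 : q < 1)
    {ν : (n : ℕ) → Fin (n + 1) → ℝ} (hν : ∀ n : ℕ, 1 ≤ n → IsCountStationary n q (ν n)) (s : ℝ) :
    Tendsto (fun n : ℕ =>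
      let z := Complex.exp ((s * entryFlux n q (ν n) : ℝ) * Complex.I)
      z ^ n * fullMass n q / (z ^ n * fullMass n q +
        (1 - z) * excursionMoment n q z n * denomProd n q z)) atTop
      (𝓝 (1 / (1 - s * Complex.I))) := by
  set μ : ℕ → ℝ := fun n => entryFlux n q (ν n) with hμ
  set z : ℕ → ℂ := fun n => Complex.exp ((s * μ n : ℝ) * Complex.I) with hz
  have hnorm : ∀ n, ‖z n‖ ≤ 1 := fun n => (Complex.norm_exp_ofReal_mul_I _).le
  have hexp : ∀ a : ℕ → ℝ, Tendsto a atTop (𝓝 0) →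
      Tendsto (fun n => Complex.exp ((s * a n : ℝ) * Complex.I)) atTop (𝓝 1) := by
    intro a ha
    have : Continuous fun x : ℝ => Complex.exp ((s * x : ℝ) * Complex.I) := by fun_prop
    simpa [Function.comp_def] using (this.tendsto 0).comp ha
  have hz1 : Tendsto z atTop (𝓝 1) := hexp μ (tendsto_entryFlux h0 h1 hν)
  have hzn : Tendsto (fun n => z n ^ n) atTop (𝓝 1) := by
    refine (hexp _ (tendsto_nat_mul_entryFlux h0 h1 hν)).congr fun n => ?_
    rw [hz, ← Complex.exp_nat_mul]
    congr 1
    push_cast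
    ring
  have hfm : Tendsto (fun n => ((fullMass n q / μ n : ℝ) : ℂ)) atTop (𝓝 (qProd q : ℂ)) :=
    (Complex.continuous_ofReal.tendsto _).comp (tendsto_fullMass_div_entryFlux h0 h1 hν)
  -- The derivative of $x\mapsto e^{isx}$ at $0$, along $\mu_n\to0$ with $\mu_n\ne0$.
  have hslope : Tendsto (fun n => (1 - z n) / (μ n : ℂ)) atTop (𝓝 (-(s * Complex.I))) := by
    have hd : HasDerivAt (fun x : ℝ => Complex.exp ((s * x : ℝ) * Complex.I))
        (s * Complex.I) 0 := by
      have e1 : HasDerivAt (fun x : ℝ => ((s * x : ℝ) : ℂ) * Complex.I) (s * Complex.I) 0 := by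
        have := ((hasDerivAt_id (0 : ℝ)).const_mul s).ofReal_comp.mul_const Complex.I
        simpa using this
      simpa using e1.cexp
    have h2 := (hasDerivAt_iff_tendsto_slope_zero.1 hd).comp
      (tendsto_nhdsWithin_iff.2 ⟨tendsto_entryFlux h0 h1 hν, by
        filter_upwards [eventually_ge_atTop 1] with n hn
        exact (entryFlux_pos h0 h1 hν hn).ne'⟩)
    refine h2.neg.congr fun n => ?_
    simp only [Function.comp_apply, zero_add, mul_zero, Complex.ofReal_zero, zero_mul,
      Complex.exp_zero, Complex.real_smul, Complex.ofReal_inv]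
    rw [div_eq_inv_mul, ← mul_neg, neg_sub]
  have hρ : Tendsto (fun n => excursionMoment n q (z n) n) atTop (𝓝 1) := by
    rw [tendsto_iff_norm_sub_tendsto_zero]
    refine squeeze_zero' (Eventually.of_forall fun _ => norm_nonneg _) ?_
      (by simpa using (tendsto_pow_atTop_nhds_zero_of_lt_one h0.le h1).div_const (1 - q))
    filter_upwards [eventually_ge_atTop 1] with n hn
    exact norm_excursionMoment_self_sub_one_le (by omega) h0.le h1 (hnorm n)
  have hQ : (qProd q : ℂ) ≠ 0 := Complex.ofReal_ne_zero.2 (qProd_ne_zero h0.le h1)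
  have hs : (1 : ℂ) - s * Complex.I ≠ 0 := fun h => by simpa using congrArg Complex.re h
  have hA := hzn.mul hfm
  have hB := hA.add ((hslope.mul hρ).mul (tendsto_denomProd h0.le h1 hnorm hz1))
  have hlim : (1 * (qProd q : ℂ)) + -(s * Complex.I) * 1 * (qProd q : ℂ) =
      (qProd q : ℂ) * (1 - s * Complex.I) := by ring
  rw [hlim] at hB
  have h := hA.div hB (mul_ne_zero hQ hs)
  rw [one_mul, ← div_div, div_self hQ] at h
  refine h.congr' ?_
  filter_upwards [eventually_ge_atTop 1] with n hn
  have hμn : (μ n : ℂ) ≠ 0 := Complex.ofReal_ne_zero.2 (entryFlux_pos h0 h1 hν hn).ne'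
  change _ = z n ^ n * (fullMass n q : ℂ) / (z n ^ n * fullMass n q +
        (1 - z n) * excursionMoment n q (z n) n * denomProd n q (z n))
  rw [Pi.div_apply, Complex.ofReal_div, ← mul_div_mul_right _ _ hμn]
  congr 1
  · field_simp
  · field_simp

lemma tendstoInDistribution_completionTime {p : unitInterval} (hp0 : 0 < p) (hp1 : p < 1)
    {ν : (n : ℕ) → Fin (n + 1) → ℝ}
    (hν : ∀ n : ℕ, 1 ≤ n → IsCountStationary n (1 - p) (ν n)) :
    TendstoInDistribution
      (fun (n : ℕ) (ω : ℕ → Round (n + 1)) =>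
        entryFlux (n + 1) (1 - p) (ν (n + 1)) * ((completionTime ω).toNat : ℝ))
      atTop (id : ℝ → ℝ) (fun n : ℕ => experiment (n + 1) p) (expMeasure 1) := by
  have h0 : (0 : ℝ) < 1 - p := sub_pos.2 hp1
  have h1 : 1 - (p : ℝ) < 1 := sub_lt_self _ hp0
  have hmeas : ∀ n : ℕ, AEMeasurable (fun ω : ℕ → Round (n + 1) =>
      entryFlux (n + 1) (1 - p) (ν (n + 1)) * ((completionTime ω).toNat : ℝ))
      (experiment (n + 1) p) := fun n => by
    exact ((measurable_of_countable fun k : ℕ =>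
      entryFlux (n + 1) (1 - p) (ν (n + 1)) * (k : ℝ)).comp
      measurable_completionTime_toNat).aemeasurable
  refine ⟨hmeas, aemeasurable_id, ?_⟩
  refine ProbabilityMeasure.tendsto_iff_tendsto_charFun.2 fun s => ?_
  simp only [ProbabilityMeasure.coe_mk, Measure.map_id, charFun_expMeasure_one,
    charFun_map_completionTime _ p hp0 hp1]
  have hlim := (tendsto_ratio_completionGF h0 h1 hν s).comp (tendsto_add_atTop_nat 1)
  have hs : (1 : ℂ) - s * Complex.I ≠ 0 := fun h => by simpa using congrArg Complex.re h
  refine hlim.congr' ?_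
  -- The limit is nonzero, so the ratio is eventually nonzero; as division by zero gives zero, its
  -- denominator is then nonzero and the identity can be solved for $F$.
  filter_upwards [hlim.eventually_ne (one_div_ne_zero hs)] with n hn
  simp only [Function.comp_apply] at hn ⊢
  rw [div_eq_iff fun h => hn (by rw [h, div_zero])]
  exact (completionGF_identity (n + 1) p hp0 (Complex.norm_exp_ofReal_mul_I _).le).symm

end CarelessCollector

open CarelessCollector in
theorem mainTheorem2 (p : unitInterval) (hp0 : 0 < p) (hp1 : p < 1)
    (q : ℝ) (hq : q = 1 - (p : ℝ)) :
    -- from any held set, the new count follows the stated count-chain transition rule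
    (∀ (n : ℕ) [NeZero n] (S : Finset (Fin n)) (k l : Fin (n + 1)), S.card = k →
      (roundLaw n p).real {r | (step S r).card = l} = countTransition n q k l) ∧
    -- the count chain has exactly one stationary law
    (∀ n : ℕ, 1 ≤ n → ∃! ν : Fin (n + 1) → ℝ, IsCountStationary n q ν) ∧
    -- completion happens almost surely
    (∀ (n : ℕ) [NeZero n], ∀ᵐ ω ∂(experiment n p), completionTime ω ≠ ⊤) ∧
    ∀ ν : (n : ℕ) → Fin (n + 1) → ℝ, (∀ n : ℕ, 1 ≤ n → IsCountStationary n q (ν n)) →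
      -- the rescaled completion time converges in distribution
      TendstoInDistribution
        (fun (n : ℕ) (ω : ℕ → Round (n + 1)) =>
          entryFlux (n + 1) q (ν (n + 1)) * ((completionTime ω).toNat : ℝ))
        atTop (id : ℝ → ℝ) (fun n : ℕ => experiment (n + 1) p) (expMeasure 1) ∧
      -- sharp asymptotics of the flux
      Asymptotics.IsEquivalent atTop (fun n : ℕ => entryFlux n q (ν n))
        (fun n : ℕ => 1 / qProd q * ((n.factorial : ℝ) / (n : ℝ) ^ n) * q ^ (n * (n + 1) / 2)) := by
  have h0 : 0 < q := hq ▸ sub_pos.2 hp1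
  have h1 : q < 1 := hq ▸ sub_lt_self _ hp0
  refine ⟨fun n _ S k l hk => hq ▸ roundLaw_card_step n p S k l hk,
    fun n hn => existsUnique_isCountStationary (by omega) h0.le h1,
    fun n _ => ae_completionTime_ne_top n p hp0 hp1,
    fun ν hν => ⟨?_, entryFlux_isEquivalent h0 h1 hν⟩⟩
  subst hq
  exact tendstoInDistribution_completionTime hp0 hp1 hν
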